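/- Let $\{(X_n,d_n,m_n)\}_{n\in\mathbb N}$ be a sequence of finite metric spaces $(X_n,d_n)$, each equipped with a non-zero finite measure $m_n$ defined on all subsets of $X_n$. For $A\subseteq X_n$ and $R>0$ write $\partial_R A=\{x\in X_n\setminus A: d_n(x,A)\le R\}$. Assume that: (i) (measured asymptotic expanders) for every $\alpha\in(0,\tfrac12]$ there exist $c_\alpha\in(0,1)$ and $R_\alpha>0$ such that for every $n$ and every $A\subseteq X_n$ with $\alpha\, m_n(X_n)\le m_n(A)\le\tfrac12 m_n(X_n)$ one has $m_n(\partial_{R_\alpha}A)>c_\alpha\, m_n(A)$; (ii) (ghostly) $\lim_{n\to\infty}\sup_{x\in X_n}\frac{m_n(\{x\})}{m_n(X_n)}=0$; (iii) (uniformly bounded geometry) for every $R>0$, $\sup_{n}\sup_{x\in X_n}|B(x,R)|<\infty$, where $B(x,R)$ is the closed ball. Let $(X,d)$ be a coarse disjoint union of $\{(X_n,d_n)\}$, that is, $X=\bigsqcup_n X_n$ and $d$ is a metric on $X$ which restricts to $d_n$ on each $X_n$ and satisfies $d(X_i,X_j)\to\infty$ as $i+j\to\infty$ with $i\ne j$.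 Then for every $p\in[1,\infty)$ and every measure space $(Z,\nu)$, the space $(X,d)$ does not coarsely embed into the (real or complex) space $L^p(Z,\nu)$: there are no map $f:X\to L^p(Z,\nu)$ and non-decreasing functions $\rho_-,\rho_+:[0,\infty)\to[0,\infty)$ with $\rho_-(t)\to\infty$ as $t\to\infty$ such that $\rho_-(d(x,y))\le\|f(x)-f(y)\|_p\le\rho_+(d(x,y))$ for all $x,y\in X$. -/

import Mathlib

open MeasureTheory Filter Topology
open scoped ENNReal NNReal

namespace MeasuredExpanders

/-- The `R`-boundary `{x ∉ A : d(x, A) ≤ R}` of a subset `A` of a metric space.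
The set `Metric.cthickening R A` is `{x : d(x, A) ≤ R}`, with `d(x, ∅) = ∞`. -/
def boundary {Y : Type*} [MetricSpace Y] (R : ℝ) (A : Set Y) : Set Y :=
  Metric.cthickening R A \ A

/-- The sequence is ghostly: the maximal relative mass of a point tends to zero. -/
def IsGhostly (X : ℕ → Type*) [∀ n, MeasurableSpace (X n)] (m : ∀ n, Measure (X n)) : Prop :=
  Tendsto (fun n => ⨆ x : X n, m n {x} / m n Set.univ) atTop (𝓝 (0 : ℝ≥0∞))

/-- Uniformly bounded geometry: for each radius, balls have uniformly bounded cardinality. -/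
def HasUniformlyBoundedGeometry (X : ℕ → Type*) [∀ n, MetricSpace (X n)] : Prop :=
  ∀ R : ℝ, 0 < R → ∃ K : ℕ, ∀ (n : ℕ) (x : X n), (Metric.closedBall x R).encard ≤ K

/-- Measured asymptotic expanders. The value of `(m n).real` at a set is its measure as a real
number. -/
def IsMeasuredAsymptoticExpander (X : ℕ → Type*) [∀ n, MetricSpace (X n)]
    [∀ n, MeasurableSpace (X n)] (m : ∀ n, Measure (X n)) : Prop :=
  ∀ α : ℝ, 0 < α → α ≤ 1 / 2 →
    ∃ c R : ℝ, 0 < c ∧ c < 1 ∧ 0 < R ∧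
      ∀ (n : ℕ) (A : Set (X n)),
        α * (m n).real Set.univ ≤ (m n).real A →
        (m n).real A ≤ 1 / 2 * (m n).real Set.univ →
        c * (m n).real A < (m n).real (boundary R A)

/-- The given metric on the disjoint union of the sets `X n` makes it a coarse disjoint union of the
metric spaces `X n`: it restricts to the metric of each `X n`, and the distance between `X i` and
`X j`, for `i ≠ j`, tends to infinity as `i + j → ∞`. -/
structure IsCoarseDisjointUnion (X : ℕ → Type*) [∀ n, MetricSpace (X n)]
    [MetricSpace (Σ n, X n)] : Prop where
  dist_same : ∀ (n : ℕ) (x y : X n), dist (⟨n, x⟩ : Σ n, X n) ⟨n, y⟩ = dist x y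
  dist_diff : ∀ R : ℝ, ∃ N : ℕ, ∀ i j : ℕ, i ≠ j → N ≤ i + j → ∀ (x : X i) (y : X j),
    R ≤ dist (⟨i, x⟩ : Σ n, X n) ⟨j, y⟩

/-- Coarse embeddings between metric spaces, with non-decreasing control functions
`ρLo, ρUp : [0, ∞) → [0, ∞)` of which the lower one tends to infinity. -/
def IsCoarseEmbedding {Y W : Type*} [MetricSpace Y] [MetricSpace W] (f : Y → W) : Prop :=
  ∃ ρLo ρUp : ℝ≥0 → ℝ≥0, Monotone ρLo ∧ Monotone ρUp ∧ Tendsto ρLo atTop atTop ∧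
    ∀ x y : Y, ρLo (nndist x y) ≤ nndist (f x) (f y) ∧ nndist (f x) (f y) ≤ ρUp (nndist x y)

end MeasuredExpanders

/-! A coarse embedding contradicts an `Lᵖ` Poincaré inequality on a single `X n` with `n` large.

Weight each pair of points at distance at most `R` by the smaller of their masses, so that bounded
geometry bounds the degree of `x` by `K * μ x`. Boundary expansion becomes expansion of cuts
(`cut_of_boundary`), but only for sets of intermediate mass. Deleting a maximal set of small cut
repairs this (`exists_cut_expanding_subset`): the remaining `Y` has at least 3/4 of the mass `M`,
and every subset of at most half its mass expands inside `Y`.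

A Cheeger argument on `Y` (co-area, a median, `p`-th powers), followed by integration over `Z`,
bounds the mass-weighted sum of `‖f x - f y‖ ^ p` over `Y × Y` by `M ^ 2` times a constant depending
on `c`, `K`, `p` and `ρUp` at `R`, but not on `n`. For fixed `S`, ghostliness and bounded geometry
make the pairs within distance `S` negligible (`sum_mul_mul_ge_of_far`), so the same sum is at least
`M ^ 2 / 2` times the `p`-th power of `ρLo S`, which is unbounded in `S`. -/

namespace MeasuredExpanders

/-! ### Cuts, co-area and medians in weighted graphs -/

section WeightedGraph

variable {V : Type*}

/-- A cut inequality for sets of intermediate mass improves, off a set of small mass, to a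
cut inequality for all sets of at most half of the mass. -/
lemma exists_cut_expanding_subset [Fintype V] [DecidableEq V] (μ : V → ℝ) (hμ : ∀ x, 0 ≤ μ x) (w : V → V → ℝ)
    (hw : ∀ x y, 0 ≤ w x y) (hsymm : ∀ x y, w x y = w y x) {c : ℝ} (hc : 0 < c)
    (hM : 0 < ∑ x, μ x)
    (hcut : ∀ A : Finset V, (∑ x, μ x) / 4 ≤ ∑ x ∈ A, μ x → ∑ x ∈ A, μ x ≤ (∑ x, μ x) / 2 →
      c * ∑ x ∈ A, μ x ≤ ∑ x ∈ A, ∑ y ∈ Aᶜ, w x y) :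
    ∃ Y : Finset V, 3 / 4 * ∑ x, μ x ≤ ∑ x ∈ Y, μ x ∧
      ∀ B ⊆ Y, ∑ x ∈ B, μ x ≤ (∑ x ∈ Y, μ x) / 2 →
        c / 4 * ∑ x ∈ B, μ x ≤ ∑ x ∈ B, ∑ y ∈ Y \ B, w x y := by
  set M := ∑ x, μ x with hMdef
  let bad : Set (Finset V) := {A | ∑ x ∈ A, μ x ≤ M / 4 ∧
    ∑ x ∈ A, ∑ y ∈ Aᶜ, w x y ≤ c / 4 * ∑ x ∈ A, μ x}
  have hne : bad.Nonempty := ⟨∅, by simp [bad]; positivity⟩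
  -- A violating `B` in the complement of a maximal bad `A` would give `A ∪ B` a small cut too, so
  -- by maximality its mass exceeds `M / 4`.
  obtain ⟨A, hA⟩ := (Set.toFinite bad).exists_maximal hne
  obtain ⟨⟨hA1, hA2⟩, hAmax⟩ := hA
  have hsplit : ∑ x ∈ A, μ x + ∑ x ∈ Aᶜ, μ x = M := Finset.sum_add_sum_compl A μ
  have hA0 : 0 ≤ ∑ x ∈ A, μ x := Finset.sum_nonneg fun x _ => hμ x
  refine ⟨Aᶜ, by linarith, fun B hB hBhalf => ?_⟩
  by_contra! hlt
  have hdisj : Disjoint A B := by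
    rw [Finset.disjoint_left]
    intro x hx hxB
    exact (Finset.mem_compl.1 (hB hxB)) hx
  have hunion : ∑ x ∈ A ∪ B, μ x = ∑ x ∈ A, μ x + ∑ x ∈ B, μ x := Finset.sum_union hdisj
  have hBA : ∑ x ∈ B, ∑ y ∈ A, w x y ≤ ∑ x ∈ A, ∑ y ∈ Aᶜ, w x y := by
    rw [Finset.sum_comm]
    refine Finset.sum_le_sum fun x _ => ?_
    calc ∑ y ∈ B, w y x = ∑ y ∈ B, w x y := Finset.sum_congr rfl fun y _ => hsymm y x
      _ ≤ _ := Finset.sum_le_sum_of_subset_of_nonneg hB fun y _ _ => hw x y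
  have hBcompl : Bᶜ = (Aᶜ \ B) ∪ A := by
    ext x
    have : x ∈ A → x ∉ B := fun h => Finset.disjoint_left.1 hdisj h
    simp only [Finset.mem_compl, Finset.mem_union, Finset.mem_sdiff]
    tauto
  have hBcut : ∑ x ∈ B, ∑ y ∈ Bᶜ, w x y
      = ∑ x ∈ B, ∑ y ∈ Aᶜ \ B, w x y + ∑ x ∈ B, ∑ y ∈ A, w x y := by
    rw [← Finset.sum_add_distrib]
    refine Finset.sum_congr rfl fun x _ => ?_
    rw [hBcompl, Finset.sum_union]
    rw [Finset.disjoint_left]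
    intro y hy hyA
    simp at hy
    exact hy.1 hyA
  have hUcut : ∑ x ∈ A ∪ B, ∑ y ∈ (A ∪ B)ᶜ, w x y
      ≤ ∑ x ∈ A, ∑ y ∈ Aᶜ, w x y + ∑ x ∈ B, ∑ y ∈ Aᶜ \ B, w x y := by
    rw [Finset.sum_union hdisj]
    refine add_le_add (Finset.sum_le_sum fun x _ => ?_) (Finset.sum_le_sum fun x _ => ?_)
    · exact Finset.sum_le_sum_of_subset_of_nonneg (by intro y; simp; tauto) fun y _ _ => hw x y
    · exact Finset.sum_le_sum_of_subset_of_nonneg (by intro y; simp) fun y _ _ => hw x y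
  have hB0 : 0 ≤ ∑ x ∈ B, μ x := Finset.sum_nonneg fun x _ => hμ x
  have hcutnn : 0 ≤ ∑ x ∈ B, ∑ y ∈ Aᶜ \ B, w x y :=
    Finset.sum_nonneg fun x _ => Finset.sum_nonneg fun y _ => hw x y
  have hBpos : 0 < ∑ x ∈ B, μ x := by
    by_contra! h
    have : ∑ x ∈ B, μ x = 0 := le_antisymm h hB0
    rw [this] at hlt
    linarith
  have hbig : M / 4 < ∑ x ∈ A ∪ B, μ x := by
    by_contra! hle
    have hmem : A ∪ B ∈ bad := ⟨hle, by rw [hunion, mul_add]; linarith⟩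
    have hsub : A ∪ B ⊆ A := hAmax hmem Finset.subset_union_left
    have hBe : B = ∅ := by
      rw [Finset.eq_empty_iff_forall_notMem]
      exact fun x hx => Finset.disjoint_left.1 hdisj (hsub (Finset.mem_union_right _ hx)) hx
    simp [hBe] at hBpos
  -- Up to `M / 2`, the union itself violates `hcut`. Beyond it, `B` alone has mass above `M / 4 ≥
  -- μ(A)`, and its cut, split into the parts towards `Aᶜ \ B` and towards `A`, is at most `c / 2`
  -- times its mass.
  by_cases hhalf : ∑ x ∈ A ∪ B, μ x ≤ M / 2
  · have h := hcut _ hbig.le hhalf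
    have : 0 < c * ∑ x ∈ A ∪ B, μ x := mul_pos hc (by linarith)
    rw [hunion] at h this
    nlinarith
  · push Not at hhalf
    have h := hcut B (by linarith) (by linarith)
    have h1 : c / 4 * ∑ x ∈ A, μ x ≤ c / 4 * ∑ x ∈ B, μ x :=
      mul_le_mul_of_nonneg_left (by linarith) (by positivity)
    have : 0 < c * ∑ x ∈ B, μ x := mul_pos hc hBpos
    linarith

/-- The co-area inequality: a cut inequality gives an `L¹` inequality for non-negative functions
with small support. -/
lemma sum_mul_le_of_cut [DecidableEq V] (Y : Finset V) (μ : V → ℝ) (hμ : ∀ x, 0 ≤ μ x) (w : V → V → ℝ)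
    (hw : ∀ x y, 0 ≤ w x y) {c h : ℝ}
    (hcut : ∀ B ⊆ Y, ∑ x ∈ B, μ x ≤ h →
        c * ∑ x ∈ B, μ x ≤ ∑ x ∈ B, ∑ y ∈ Y \ B, w x y)
    (u : V → ℝ) (hu : ∀ x, 0 ≤ u x) (hsupp : ∑ x ∈ Y with 0 < u x, μ x ≤ h) :
    c * ∑ x ∈ Y, μ x * u x ≤ ∑ x ∈ Y, ∑ y ∈ Y, w x y * |u x - u y| := by
  induction hn : (Y.filter fun x => 0 < u x).card using Nat.strong_induction_on generalizing u with
  | _ n ih =>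
  set S := Y.filter fun x => 0 < u x with hS
  rcases S.eq_empty_or_nonempty with hSe | hSne
  · have h0 : ∑ x ∈ Y, μ x * u x = 0 := by
      refine Finset.sum_eq_zero fun x hx => ?_
      have : ¬ 0 < u x := Finset.filter_eq_empty_iff.1 hSe hx
      rw [le_antisymm (not_lt.1 this) (hu x), mul_zero]
    rw [h0, mul_zero]
    exact Finset.sum_nonneg fun x _ => Finset.sum_nonneg fun y _ =>
      mul_nonneg (hw x y) (abs_nonneg _)
  · obtain ⟨a, haS, ha⟩ := S.exists_min_image u hSne
    have ha0 : 0 < u a := (Finset.mem_filter.1 haS).2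
    -- Peel off the lowest positive level: on `Y`, `u` is `u a` times the indicator of `S` plus `v`.
    -- Both sides of the inequality are additive in this splitting, and `v` has smaller support.
    let v : V → ℝ := fun x => max (u x - u a) 0
    have hsub : (Y.filter fun x => 0 < v x) ⊂ S := by
      rw [Finset.ssubset_iff_of_subset]
      · exact ⟨a, haS, by simp [v]⟩
      · intro x hx
        simp only [Finset.mem_filter, v, lt_max_iff, lt_irrefl, or_false, hS] at hx ⊢
        exact ⟨hx.1, by linarith [hx.2]⟩
    have hv := ih _ (hn ▸ Finset.card_lt_card hsub) v (fun x => le_max_right _ _)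
      ((Finset.sum_le_sum_of_subset_of_nonneg hsub.1 fun x _ _ => hμ x).trans hsupp) rfl
    have hcS := mul_le_mul_of_nonneg_left (hcut S (Finset.filter_subset _ _) hsupp) ha0.le
    have hvS : ∀ x ∈ Y, 0 < u x → v x = u x - u a := fun x hx h => by
      have := ha x (Finset.mem_filter.2 ⟨hx, h⟩)
      simp only [v]
      exact max_eq_left (by linarith)
    have hvS' : ∀ x, ¬ 0 < u x → u x = 0 ∧ v x = 0 := fun x h => by
      have : u x = 0 := le_antisymm (not_lt.1 h) (hu x)
      simp only [v, this, true_and]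
      exact max_eq_right (by linarith)
    have hleft : ∑ x ∈ Y, μ x * u x = u a * ∑ x ∈ S, μ x + ∑ x ∈ Y, μ x * v x := by
      rw [hS, Finset.sum_filter, Finset.mul_sum, ← Finset.sum_add_distrib]
      refine Finset.sum_congr rfl fun x hx => ?_
      split_ifs with h
      · rw [hvS x hx h]; ring
      · rw [(hvS' x h).1, (hvS' x h).2]; ring
    have hYS : Y \ S = Y.filter fun x => ¬ 0 < u x := by rw [hS, Finset.filter_not]
    have hright : u a * ∑ x ∈ S, ∑ y ∈ Y \ S, w x y + ∑ x ∈ Y, ∑ y ∈ Y, w x y * |v x - v y|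
        ≤ ∑ x ∈ Y, ∑ y ∈ Y, w x y * |u x - u y| := by
      rw [hYS, hS, Finset.sum_filter, Finset.mul_sum, ← Finset.sum_add_distrib]
      refine Finset.sum_le_sum fun x hx => ?_
      rw [Finset.sum_filter]
      split_ifs with h
      · rw [Finset.mul_sum, ← Finset.sum_add_distrib]
        refine Finset.sum_le_sum fun y hy => ?_
        split_ifs with h'
        · rw [hvS x hx h, hvS y hy h']; simp
        · rw [(hvS' y h').1, (hvS' y h').2, hvS x hx h, sub_zero, sub_zero, abs_of_pos h,
            abs_of_nonneg (by linarith [ha x (Finset.mem_filter.2 ⟨hx, h⟩)])]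
          exact le_of_eq (by ring)
      · rw [mul_zero, zero_add]
        refine Finset.sum_le_sum fun y hy => mul_le_mul_of_nonneg_left ?_ (hw x y)
        rw [(hvS' x h).1, (hvS' x h).2]
        by_cases h' : 0 < u y
        · rw [hvS y hy h', zero_sub, zero_sub, abs_neg, abs_neg, abs_of_pos h',
            abs_of_nonneg (by linarith [ha y (Finset.mem_filter.2 ⟨hy, h'⟩)])]
          linarith
        · rw [(hvS' y h').1, (hvS' y h').2]
    rw [hleft]
    linarith

/-- A weighted finite family of reals has a median. -/
lemma exists_median (Y : Finset V) (hY : Y.Nonempty) (μ : V → ℝ) (hμ : ∀ x, 0 ≤ μ x)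
    (g : V → ℝ) :
    ∃ t : ℝ, ∑ x ∈ Y with t < g x, μ x ≤ (∑ x ∈ Y, μ x) / 2 ∧
      ∑ x ∈ Y with g x < t, μ x ≤ (∑ x ∈ Y, μ x) / 2 := by
  have hM : 0 ≤ ∑ x ∈ Y, μ x := Finset.sum_nonneg fun x _ => hμ x
  let T := Y.filter fun a => ∑ x ∈ Y with g a < g x, μ x ≤ (∑ x ∈ Y, μ x) / 2
  have hT : T.Nonempty := by
    obtain ⟨b, hb, hmax⟩ := Y.exists_max_image g hY
    refine ⟨b, Finset.mem_filter.2 ⟨hb, ?_⟩⟩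
    rw [Finset.filter_false_of_mem fun x hx => not_lt.2 (hmax x hx)]
    simpa using by linarith
  obtain ⟨a, haT, ha⟩ := T.exists_min_image g hT
  refine ⟨g a, (Finset.mem_filter.1 haT).2, ?_⟩
  by_contra! hlt
  have hne : (Y.filter fun x => g x < g a).Nonempty := by
    by_contra h
    rw [Finset.not_nonempty_iff_eq_empty] at h
    rw [h, Finset.sum_empty] at hlt
    linarith
  -- `g b` is the next value below `g a`, so the points above it all have `g ≥ g a` and carry less
  -- than half of the mass; this contradicts minimality of `a`.
  obtain ⟨b, hb, hbmax⟩ := Finset.exists_max_image _ g hne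
  rw [Finset.mem_filter] at hb
  have hbT : b ∈ T := by
    refine Finset.mem_filter.2 ⟨hb.1, ?_⟩
    have hsum := Finset.sum_filter_add_sum_filter_not Y (fun x => g x < g a) μ
    have hle : ∑ x ∈ Y with g b < g x, μ x ≤ ∑ x ∈ Y with ¬ g x < g a, μ x := by
      refine Finset.sum_le_sum_of_subset_of_nonneg ?_ fun x _ _ => hμ x
      intro x hx
      rw [Finset.mem_filter] at hx ⊢
      exact ⟨hx.1, fun h => not_le.2 hx.2 (hbmax x (Finset.mem_filter.2 ⟨hx.1, h⟩))⟩
    linarith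
  linarith [ha b hbT, hb.2]

end WeightedGraph

/-- Either `a - b ≤ δ * a`, and Bernoulli's inequality gives the first term, or `a ≤ δ⁻¹ * (a - b)`,
which gives the second. This takes the place of Hölder's inequality in passing from `L¹` to `Lᵖ`:
for small `δ` the first term can be absorbed. -/
lemma abs_rpow_sub_rpow_le {p δ : ℝ} (hp : 1 ≤ p) (hδ : 0 < δ) (hδ1 : δ ≤ 1) {a b : ℝ}
    (ha : 0 ≤ a) (hb : 0 ≤ b) :
    |a ^ p - b ^ p| ≤ p * δ * (a ^ p + b ^ p) + (δ⁻¹) ^ p * |a - b| ^ p := by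
  wlog hab : b ≤ a generalizing a b
  · have := this hb ha (le_of_not_ge hab)
    rwa [abs_sub_comm, add_comm (a ^ p), abs_sub_comm a b]
  have hp0 : 0 ≤ p := by linarith
  have hle : b ^ p ≤ a ^ p := Real.rpow_le_rpow hb hab hp0
  have hbp : 0 ≤ b ^ p := Real.rpow_nonneg hb p
  have hap : 0 ≤ a ^ p := Real.rpow_nonneg ha p
  rw [abs_of_nonneg (sub_nonneg.2 hle), abs_of_nonneg (sub_nonneg.2 hab),
    ← Real.mul_rpow (inv_nonneg.2 hδ.le) (sub_nonneg.2 hab)]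
  by_cases h : a - b ≤ δ * a
  · have h1 : (1 - δ) ^ p * a ^ p ≤ b ^ p := by
      rw [← Real.mul_rpow (by linarith) ha]
      exact Real.rpow_le_rpow (mul_nonneg (by linarith) ha) (by linarith) hp0
    have h2 : 1 + p * (-δ) ≤ (1 + -δ) ^ p := one_add_mul_self_le_rpow_one_add (by linarith) hp
    have h3 := mul_le_mul_of_nonneg_right h2 hap
    have h4 : 0 ≤ (δ⁻¹ * (a - b)) ^ p :=
      Real.rpow_nonneg (mul_nonneg (inv_nonneg.2 hδ.le) (sub_nonneg.2 hab)) p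
    have h5 : 0 ≤ p * δ * b ^ p := by positivity
    rw [← sub_eq_add_neg] at h3
    linarith
  · push Not at h
    have h1 : a ≤ δ⁻¹ * (a - b) := by
      rw [inv_mul_eq_div, le_div_iff₀ hδ]; linarith
    have h2 := Real.rpow_le_rpow ha h1 hp0
    have : 0 ≤ p * δ * (a ^ p + b ^ p) := by positivity
    linarith

/-! ### Poincaré inequalities for scalar functions -/

section Poincare

lemma add_rpow_le_two_rpow_mul {p a b : ℝ} (hp : 0 ≤ p) (ha : 0 ≤ a) (hb : 0 ≤ b) :
    (a + b) ^ p ≤ 2 ^ p * (a ^ p + b ^ p) := by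
  wlog hab : b ≤ a generalizing a b
  · rw [add_comm a, add_comm (a ^ p)]
    exact this hb ha (le_of_not_ge hab)
  calc (a + b) ^ p ≤ (2 * a) ^ p := Real.rpow_le_rpow (by positivity) (by linarith) hp
    _ = 2 ^ p * a ^ p := Real.mul_rpow (by norm_num) ha
    _ ≤ _ := mul_le_mul_of_nonneg_left (by linarith [Real.rpow_nonneg hb p]) (by positivity)

lemma rclike_norm_le_abs_re_add_abs_im {𝕜 : Type*} [RCLike 𝕜] (z : 𝕜) :
    ‖z‖ ≤ |RCLike.re z| + |RCLike.im z| := by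
  refine (sq_le_sq₀ (norm_nonneg z) (by positivity)).1 ?_
  rw [RCLike.norm_sq_eq_def, ← sq, ← sq, ← sq_abs (RCLike.re z), ← sq_abs (RCLike.im z)]
  nlinarith [abs_nonneg (RCLike.re z), abs_nonneg (RCLike.im z)]

/-- The constant in the `Lᵖ` Poincaré inequality of a weighted graph with cut constant `c` and
degree bound `K`, for functions with small support. -/
noncomputable def poincareConst (c K p : ℝ) : ℝ := 2 / c * ((4 * p * K + c) / c) ^ p

lemma poincareConst_nonneg {c K p : ℝ} (hc : 0 < c) (hK : 0 ≤ K) (hp : 1 ≤ p) :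
    0 ≤ poincareConst c K p := by
  have : 0 ≤ p := by linarith
  unfold poincareConst
  positivity

variable {V : Type*} [DecidableEq V] {Y : Finset V} {μ : V → ℝ} {w : V → V → ℝ} {c h K p : ℝ}

/-- The co-area inequality is applied to `u ^ p`, which has the same support as `u`. -/
lemma sum_mul_rpow_le_of_cut (hμ : ∀ x, 0 ≤ μ x)
    (hw : ∀ x y, 0 ≤ w x y) (hsymm : ∀ x y, w x y = w y x) (hc : 0 < c) (hK : 0 ≤ K)
    (hp : 1 ≤ p) (hdeg : ∀ x ∈ Y, ∑ y ∈ Y, w x y ≤ K * μ x)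
    (hcut : ∀ B ⊆ Y, ∑ x ∈ B, μ x ≤ h →
        c * ∑ x ∈ B, μ x ≤ ∑ x ∈ B, ∑ y ∈ Y \ B, w x y)
    (u : V → ℝ) (hu : ∀ x, 0 ≤ u x) (hsupp : ∑ x ∈ Y with 0 < u x, μ x ≤ h) :
    ∑ x ∈ Y, μ x * u x ^ p ≤
      poincareConst c K p * ∑ x ∈ Y, ∑ y ∈ Y, w x y * |u x - u y| ^ p := by
  have hp0 : 0 < p := by linarith
  -- With this `δ` the degree bound makes the error term at most `c / 2 * N`, half of the left side.
  -- The summand `c` ensures `δ ≤ 1` and a positive denominator even if `K = 0`.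
  set δ : ℝ := c / (4 * p * K + c) with hδ
  have hden : 0 < 4 * p * K + c := by positivity
  have hδ0 : 0 < δ := by positivity
  have hδ1 : δ ≤ 1 := by
    rw [hδ, div_le_one hden]
    have : 0 ≤ 4 * p * K := by positivity
    linarith
  have hδK : p * δ * (2 * K) ≤ c / 2 := by
    have h1 : δ * (4 * p * K + c) = c := div_mul_cancel₀ _ hden.ne'
    have h2 : 0 ≤ δ * c := by positivity
    linarith
  set E := ∑ x ∈ Y, ∑ y ∈ Y, w x y * |u x - u y| ^ p
  set N := ∑ x ∈ Y, μ x * u x ^ p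
  have hup : ∀ x, 0 ≤ u x ^ p := fun x => Real.rpow_nonneg (hu x) p
  have hN : 0 ≤ N := Finset.sum_nonneg fun x _ => mul_nonneg (hμ x) (hup x)
  have h1 : c * N ≤ ∑ x ∈ Y, ∑ y ∈ Y, w x y * |u x ^ p - u y ^ p| := by
    refine sum_mul_le_of_cut Y μ hμ w hw hcut (fun x => u x ^ p) hup ?_
    refine le_trans (Finset.sum_le_sum_of_subset_of_nonneg ?_ fun x _ _ => hμ x) hsupp
    intro x hx
    rw [Finset.mem_filter] at hx ⊢
    refine ⟨hx.1, (hu x).lt_of_ne fun h => ?_⟩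
    rw [← h, Real.zero_rpow hp0.ne'] at hx
    exact lt_irrefl _ hx.2
  have hdegsum : ∑ x ∈ Y, ∑ y ∈ Y, w x y * u x ^ p ≤ K * N := by
    rw [Finset.mul_sum]
    refine Finset.sum_le_sum fun x hx => ?_
    rw [← Finset.sum_mul, ← mul_assoc]
    exact mul_le_mul_of_nonneg_right (hdeg x hx) (hup x)
  have hdegsum' : ∑ x ∈ Y, ∑ y ∈ Y, w x y * u y ^ p ≤ K * N := by
    rw [Finset.sum_comm]
    refine le_trans (le_of_eq ?_) hdegsum
    exact Finset.sum_congr rfl fun x _ => Finset.sum_congr rfl fun y _ => by rw [hsymm]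
  have h2 : ∑ x ∈ Y, ∑ y ∈ Y, w x y * |u x ^ p - u y ^ p| ≤
      p * δ * (∑ x ∈ Y, ∑ y ∈ Y, w x y * u x ^ p + ∑ x ∈ Y, ∑ y ∈ Y, w x y * u y ^ p)
        + (δ⁻¹) ^ p * E := by
    simp only [E, ← Finset.sum_add_distrib, Finset.mul_sum]
    refine Finset.sum_le_sum fun x _ => Finset.sum_le_sum fun y _ => ?_
    have := mul_le_mul_of_nonneg_left (abs_rpow_sub_rpow_le hp hδ0 hδ1 (hu x) (hu y)) (hw x y)
    linarith
  have h3 : p * δ * (∑ x ∈ Y, ∑ y ∈ Y, w x y * u x ^ p + ∑ x ∈ Y, ∑ y ∈ Y, w x y * u y ^ p)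
      ≤ c / 2 * N := by
    calc _ ≤ p * δ * (K * N + K * N) :=
          mul_le_mul_of_nonneg_left (add_le_add hdegsum hdegsum') (by positivity)
      _ = p * δ * (2 * K) * N := by ring
      _ ≤ _ := mul_le_mul_of_nonneg_right hδK hN
  have h4 : c / 2 * N ≤ (δ⁻¹) ^ p * E := by linarith
  have h5 : N ≤ 2 / c * ((δ⁻¹) ^ p * E) := by
    calc N = 2 / c * (c / 2 * N) := by field_simp
      _ ≤ _ := mul_le_mul_of_nonneg_left h4 (by positivity)
  rwa [← mul_assoc, hδ, inv_div] at h5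

/-- Around a median `t`, the positive and negative parts of `g - t` each live on at most half of the
mass, so the small-support inequality applies to both. The triangle inequality through `t` then
gives the double sum. -/
lemma sum_mul_abs_sub_rpow_le_of_cut (hμ : ∀ x, 0 ≤ μ x)
    (hw : ∀ x y, 0 ≤ w x y) (hsymm : ∀ x y, w x y = w y x) (hc : 0 < c) (hK : 0 ≤ K)
    (hp : 1 ≤ p) (hdeg : ∀ x ∈ Y, ∑ y ∈ Y, w x y ≤ K * μ x)
    (hcut : ∀ B ⊆ Y, ∑ x ∈ B, μ x ≤ (∑ x ∈ Y, μ x) / 2 →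
        c * ∑ x ∈ B, μ x ≤ ∑ x ∈ B, ∑ y ∈ Y \ B, w x y)
    (g : V → ℝ) :
    ∑ x ∈ Y, ∑ y ∈ Y, μ x * μ y * |g x - g y| ^ p ≤
      2 ^ p * 4 * poincareConst c K p * (∑ x ∈ Y, μ x) *
        ∑ x ∈ Y, ∑ y ∈ Y, w x y * |g x - g y| ^ p := by
  rcases Y.eq_empty_or_nonempty with rfl | hY
  · simp
  have hp0 : 0 < p := by linarith
  obtain ⟨t, ht1, ht2⟩ := exists_median Y hY μ hμ g
  set E := ∑ x ∈ Y, ∑ y ∈ Y, w x y * |g x - g y| ^ p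
  set M := ∑ x ∈ Y, μ x
  set N := ∑ x ∈ Y, μ x * |g x - t| ^ p with hN
  have hM : 0 ≤ M := Finset.sum_nonneg fun x _ => hμ x
  have hC := poincareConst_nonneg hc hK hp
  have key : ∀ u : V → ℝ, (∀ x, 0 ≤ u x) → (∑ x ∈ Y with 0 < u x, μ x ≤ M / 2) →
      (∀ x y, |u x - u y| ≤ |g x - g y|) →
      ∑ x ∈ Y, μ x * u x ^ p ≤ poincareConst c K p * E := fun u hu hs hlip =>
    (sum_mul_rpow_le_of_cut hμ hw hsymm hc hK hp hdeg hcut u hu hs).trans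
      (mul_le_mul_of_nonneg_left (Finset.sum_le_sum fun x _ => Finset.sum_le_sum fun y _ =>
        mul_le_mul_of_nonneg_left (Real.rpow_le_rpow (abs_nonneg _) (hlip x y) hp0.le) (hw x y)) hC)
  have hpos := key (fun x => max (g x - t) 0) (fun x => le_max_right _ _)
    (by simpa [lt_max_iff] using ht1)
    (fun x y => (abs_max_sub_max_le_abs _ _ _).trans (le_of_eq (by ring_nf)))
  have hneg := key (fun x => max (t - g x) 0) (fun x => le_max_right _ _)
    (by simpa [lt_max_iff] using ht2)
    (fun x y => (abs_max_sub_max_le_abs _ _ _).trans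
      (le_of_eq (by rw [abs_sub_comm]; ring_nf)))
  have hNle : N ≤ 2 * poincareConst c K p * E := by
    have : N = ∑ x ∈ Y, μ x * (max (g x - t) 0) ^ p + ∑ x ∈ Y, μ x * (max (t - g x) 0) ^ p := by
      rw [hN, ← Finset.sum_add_distrib]
      refine Finset.sum_congr rfl fun x _ => ?_
      rcases le_total t (g x) with h | h
      · rw [max_eq_left (sub_nonneg.2 h), max_eq_right (sub_nonpos.2 h),
          abs_of_nonneg (sub_nonneg.2 h), Real.zero_rpow hp0.ne']
        ring
      · rw [max_eq_right (sub_nonpos.2 h), max_eq_left (sub_nonneg.2 h), abs_sub_comm,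
          abs_of_nonneg (sub_nonneg.2 h), Real.zero_rpow hp0.ne']
        ring
    rw [this]
    linarith
  have hsum : ∑ x ∈ Y, ∑ y ∈ Y, μ x * μ y * |g x - g y| ^ p ≤ 2 ^ p * (2 * M * N) := by
    have heq : 2 * M * N = ∑ x ∈ Y, ∑ y ∈ Y,
        (μ x * (μ y * |g y - t| ^ p) + μ y * (μ x * |g x - t| ^ p)) := by
      simp only [Finset.sum_add_distrib, ← Finset.mul_sum, ← Finset.sum_mul]
      ring
    rw [heq]
    simp only [Finset.mul_sum]
    refine Finset.sum_le_sum fun x _ => Finset.sum_le_sum fun y _ => ?_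
    have h1 : |g x - g y| ^ p ≤ (|g x - t| + |g y - t|) ^ p := by
      refine Real.rpow_le_rpow (abs_nonneg _) ?_ hp0.le
      rw [abs_sub_comm (g y)]
      exact abs_sub_le _ _ _
    have h2 := h1.trans (add_rpow_le_two_rpow_mul hp0.le (abs_nonneg _) (abs_nonneg _))
    have := mul_le_mul_of_nonneg_left h2 (mul_nonneg (hμ x) (hμ y))
    linarith
  calc _ ≤ _ := hsum
    _ ≤ 2 ^ p * (2 * M * (2 * poincareConst c K p * E)) := by gcongr
    _ = _ := by ring

/-- Real and imaginary parts are treated separately, at the cost of a factor `2 ^ p * 2`. -/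
lemma sum_mul_norm_sub_rpow_le_of_cut {𝕜 : Type*} [RCLike 𝕜] (hμ : ∀ x, 0 ≤ μ x)
    (hw : ∀ x y, 0 ≤ w x y) (hsymm : ∀ x y, w x y = w y x) (hc : 0 < c) (hK : 0 ≤ K)
    (hp : 1 ≤ p) (hdeg : ∀ x ∈ Y, ∑ y ∈ Y, w x y ≤ K * μ x)
    (hcut : ∀ B ⊆ Y, ∑ x ∈ B, μ x ≤ (∑ x ∈ Y, μ x) / 2 →
        c * ∑ x ∈ B, μ x ≤ ∑ x ∈ B, ∑ y ∈ Y \ B, w x y)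
    (g : V → 𝕜) :
    ∑ x ∈ Y, ∑ y ∈ Y, μ x * μ y * ‖g x - g y‖ ^ p ≤
      2 ^ p * 2 * (2 ^ p * 4 * poincareConst c K p) * (∑ x ∈ Y, μ x) *
        ∑ x ∈ Y, ∑ y ∈ Y, w x y * ‖g x - g y‖ ^ p := by
  have hp0 : 0 ≤ p := by linarith
  have hC := poincareConst_nonneg hc hK hp
  have hM : 0 ≤ ∑ x ∈ Y, μ x := Finset.sum_nonneg fun x _ => hμ x
  have key : ∀ φ : V → ℝ, (∀ x y, |φ x - φ y| ≤ ‖g x - g y‖) →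
      ∑ x ∈ Y, ∑ y ∈ Y, μ x * μ y * |φ x - φ y| ^ p ≤
      2 ^ p * 4 * poincareConst c K p * (∑ x ∈ Y, μ x) *
        ∑ x ∈ Y, ∑ y ∈ Y, w x y * ‖g x - g y‖ ^ p := fun φ hφ =>
    (sum_mul_abs_sub_rpow_le_of_cut hμ hw hsymm hc hK hp hdeg hcut φ).trans
      (mul_le_mul_of_nonneg_left (Finset.sum_le_sum fun x _ => Finset.sum_le_sum fun y _ =>
        mul_le_mul_of_nonneg_left (Real.rpow_le_rpow (abs_nonneg _) (hφ x y) hp0) (hw x y))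
        (by positivity))
  have hre := key (fun x => RCLike.re (g x)) fun x y => by
    rw [← map_sub]; exact RCLike.abs_re_le_norm _
  have him := key (fun x => RCLike.im (g x)) fun x y => by
    rw [← map_sub]; exact RCLike.abs_im_le_norm _
  have hsum : ∑ x ∈ Y, ∑ y ∈ Y, μ x * μ y * ‖g x - g y‖ ^ p ≤
      2 ^ p * (∑ x ∈ Y, ∑ y ∈ Y, μ x * μ y * |RCLike.re (g x) - RCLike.re (g y)| ^ p
        + ∑ x ∈ Y, ∑ y ∈ Y, μ x * μ y * |RCLike.im (g x) - RCLike.im (g y)| ^ p) := by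
    simp only [← Finset.sum_add_distrib, Finset.mul_sum]
    refine Finset.sum_le_sum fun x _ => Finset.sum_le_sum fun y _ => ?_
    rw [← map_sub, ← map_sub]
    have h1 := (Real.rpow_le_rpow (norm_nonneg _) (rclike_norm_le_abs_re_add_abs_im (g x - g y))
      hp0).trans (add_rpow_le_two_rpow_mul hp0 (abs_nonneg _) (abs_nonneg _))
    have := mul_le_mul_of_nonneg_left h1 (mul_nonneg (hμ x) (hμ y))
    linarith
  calc _ ≤ _ := hsum
    _ ≤ 2 ^ p * (_ + _) := mul_le_mul_of_nonneg_left (add_le_add hre him) (by positivity)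
    _ = _ := by ring

end Poincare

/-! ### From scalars to `Lᵖ` by integration -/

section Lp

variable {Z : Type*} [MeasurableSpace Z] {ν : Measure Z} {q : ℝ≥0∞}

lemma Lp_norm_rpow_eq_integral {E : Type*} [NormedAddCommGroup E] (hq : 1 ≤ q) (hq' : q ≠ ∞)
    (f : Lp E q ν) : ‖f‖ ^ q.toReal = ∫ z, ‖f z‖ ^ q.toReal ∂ν := by
  have hq0 : q ≠ 0 := (zero_lt_one.trans_le hq).ne'
  have h := lpNorm_eq_integral_norm_rpow_toReal hq0 hq' (Lp.aestronglyMeasurable f)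
  rw [← toReal_eLpNorm (Lp.aestronglyMeasurable f), ← Lp.norm_def] at h
  rw [h, Real.rpow_inv_rpow (integral_nonneg fun z => by positivity)
    (ENNReal.toReal_pos hq0 hq').ne']

/-- A pointwise inequality between weighted sums of `q`-th powers of distances integrates to an
inequality in `Lᵖ`. -/
lemma Lp_sum_mul_norm_sub_rpow_le {V E : Type*} [NormedAddCommGroup E] (hq : 1 ≤ q) (hq' : q ≠ ∞)
    (Y : Finset V) (a b : V → V → ℝ) {C : ℝ}
    (hab : ∀ g : V → E, ∑ x ∈ Y, ∑ y ∈ Y, a x y * ‖g x - g y‖ ^ q.toReal ≤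
      C * ∑ x ∈ Y, ∑ y ∈ Y, b x y * ‖g x - g y‖ ^ q.toReal) (f : V → Lp E q ν) :
    ∑ x ∈ Y, ∑ y ∈ Y, a x y * ‖f x - f y‖ ^ q.toReal ≤
      C * ∑ x ∈ Y, ∑ y ∈ Y, b x y * ‖f x - f y‖ ^ q.toReal := by
  have hq0 : q ≠ 0 := (zero_lt_one.trans_le hq).ne'
  have hae : ∀ x y, (fun z => ‖(f x - f y) z‖ ^ q.toReal) =ᵐ[ν]
      fun z => ‖f x z - f y z‖ ^ q.toReal := fun x y => by
    filter_upwards [Lp.coeFn_sub (f x) (f y)] with z hz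
    rw [hz, Pi.sub_apply]
  have hint : ∀ x y, Integrable (fun z => ‖f x z - f y z‖ ^ q.toReal) ν := fun x y =>
    ((Lp.memLp (f x - f y)).integrable_norm_rpow hq0 hq').congr (hae x y)
  have heq : ∀ x y, ‖f x - f y‖ ^ q.toReal = ∫ z, ‖f x z - f y z‖ ^ q.toReal ∂ν := fun x y => by
    rw [Lp_norm_rpow_eq_integral hq hq', integral_congr_ae (hae x y)]
  have hsum : ∀ k : V → V → ℝ, ∑ x ∈ Y, ∑ y ∈ Y, k x y * ‖f x - f y‖ ^ q.toReal =
      ∫ z, ∑ x ∈ Y, ∑ y ∈ Y, k x y * ‖f x z - f y z‖ ^ q.toReal ∂ν := fun k => by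
    rw [integral_finsetSum _ fun x _ => integrable_finsetSum _ fun y _ => (hint x y).const_mul _]
    refine Finset.sum_congr rfl fun x _ => ?_
    rw [integral_finsetSum _ fun y _ => (hint x y).const_mul _]
    exact Finset.sum_congr rfl fun y _ => by rw [heq, integral_const_mul]
  have hi : ∀ k : V → V → ℝ,
      Integrable (fun z => ∑ x ∈ Y, ∑ y ∈ Y, k x y * ‖f x z - f y z‖ ^ q.toReal) ν := fun k =>
    integrable_finsetSum _ fun x _ => integrable_finsetSum _ fun y _ => (hint x y).const_mul _
  rw [hsum a, hsum b, ← integral_const_mul]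
  exact integral_mono (hi a) ((hi b).const_mul C) fun z => hab fun x => f x z

end Lp

/-! ### The weighted graph of a finite metric measure space -/

section MetricGraph

variable {V : Type*} [MetricSpace V]

/-- The weight on pairs of points at distance at most `R` given by the smaller of their masses. -/
noncomputable def edgeWeight (μ : V → ℝ) (R : ℝ) (x y : V) : ℝ :=
  if dist x y ≤ R then min (μ x) (μ y) else 0

lemma edgeWeight_nonneg {μ : V → ℝ} (hμ : ∀ x, 0 ≤ μ x) (R : ℝ) (x y : V) :
    0 ≤ edgeWeight μ R x y := by
  unfold edgeWeight
  split_ifs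
  · exact le_min (hμ x) (hμ y)
  · exact le_rfl

lemma edgeWeight_comm (μ : V → ℝ) (R : ℝ) (x y : V) : edgeWeight μ R x y = edgeWeight μ R y x := by
  simp only [edgeWeight, dist_comm x y, min_comm (μ x)]

variable [Fintype V]

lemma sum_edgeWeight_le {μ : V → ℝ} (hμ : ∀ x, 0 ≤ μ x) {R K : ℝ} (Y : Finset V) (x : V)
    (hK : ((Finset.univ.filter fun y => dist x y ≤ R).card : ℝ) ≤ K) :
    ∑ y ∈ Y, edgeWeight μ R x y ≤ K * μ x := by
  calc ∑ y ∈ Y, edgeWeight μ R x y ≤ ∑ y, edgeWeight μ R x y :=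
        Finset.sum_le_sum_of_subset_of_nonneg (Finset.subset_univ _)
          fun y _ _ => edgeWeight_nonneg hμ R x y
    _ = ∑ y with dist x y ≤ R, min (μ x) (μ y) := by rw [Finset.sum_filter]; rfl
    _ ≤ ∑ y with dist x y ≤ R, μ x := Finset.sum_le_sum fun y _ => min_le_left _ _
    _ = ((Finset.univ.filter fun y => dist x y ≤ R).card : ℝ) * μ x := by simp
    _ ≤ K * μ x := mul_le_mul_of_nonneg_right hK (hμ x)

/-- The points having a neighbour of much larger mass carry little mass. -/
lemma sum_filter_exists_lt_le [DecidableEq V] {μ : V → ℝ} (hμ : ∀ x, 0 ≤ μ x) {R K L : ℝ}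
    (hK : ∀ x : V, ((Finset.univ.filter fun y => dist x y ≤ R).card : ℝ) ≤ K)
    (D : Finset V) (hD : ∀ x ∈ D, ∃ y, dist x y ≤ R ∧ L * μ x < μ y) :
    L * ∑ x ∈ D, μ x ≤ K * ∑ x, μ x := by
  calc L * ∑ x ∈ D, μ x = ∑ x ∈ D, L * μ x := Finset.mul_sum _ _ _
    _ ≤ ∑ x ∈ D, ∑ y, (if dist x y ≤ R then μ y else 0) := by
        refine Finset.sum_le_sum fun x hx => ?_
        obtain ⟨y, hy, hlt⟩ := hD x hx
        refine hlt.le.trans ?_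
        have := Finset.single_le_sum (f := fun y => if dist x y ≤ R then μ y else 0)
          (fun z _ => by split_ifs; exacts [hμ z, le_rfl]) (Finset.mem_univ y)
        simpa [hy] using this
    _ ≤ ∑ x, ∑ y, (if dist x y ≤ R then μ y else 0) :=
        Finset.sum_le_sum_of_subset_of_nonneg (Finset.subset_univ _) fun x _ _ =>
          Finset.sum_nonneg fun z _ => by split_ifs; exacts [hμ z, le_rfl]
    _ = ∑ y, ((Finset.univ.filter fun x => dist y x ≤ R).card : ℝ) * μ y := by
        rw [Finset.sum_comm]
        refine Finset.sum_congr rfl fun y _ => ?_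
        rw [← Finset.sum_filter]
        simp [dist_comm]
    _ ≤ ∑ y, K * μ y := Finset.sum_le_sum fun y _ => mul_le_mul_of_nonneg_right (hK y) (hμ y)
    _ = K * ∑ x, μ x := (Finset.mul_sum _ _ _).symm

/-- The ratio of masses of neighbouring points beyond which their edge is disregarded. -/
noncomputable def massRatio (c K : ℝ) : ℝ := 16 * K / c + 8

/-- Expansion of boundaries gives expansion of cuts. -/
lemma cut_of_boundary [DecidableEq V] {μ : V → ℝ} (hμ : ∀ x, 0 ≤ μ x) {R K c : ℝ}
    (hc : 0 < c) (hc1 : c < 1) (hK0 : 0 ≤ K)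
    (hK : ∀ x : V, ((Finset.univ.filter fun y => dist x y ≤ R).card : ℝ) ≤ K)
    (hexp : ∀ A : Finset V, 1 / 8 * ∑ x, μ x ≤ ∑ x ∈ A, μ x →
      ∑ x ∈ A, μ x ≤ 1 / 2 * ∑ x, μ x →
      c * ∑ x ∈ A, μ x ≤ ∑ y with y ∉ A ∧ ∃ x ∈ A, dist y x ≤ R, μ y)
    (A : Finset V) (hA : (∑ x, μ x) / 4 ≤ ∑ x ∈ A, μ x) (hA' : ∑ x ∈ A, μ x ≤ (∑ x, μ x) / 2) :
    c / (8 * massRatio c K) * ∑ x ∈ A, μ x ≤ ∑ x ∈ A, ∑ y ∈ Aᶜ, edgeWeight μ R x y := by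
  classical
  set M := ∑ x, μ x
  have hM0 : 0 ≤ M := Finset.sum_nonneg fun x _ => hμ x
  set L := massRatio c K with hLdef
  have hKc : 0 ≤ 16 * K / c := by positivity
  have hL8 : 8 ≤ L := by rw [hLdef, massRatio]; linarith
  have hL0 : 0 < L := by linarith
  have hKL : 16 * K ≤ c * L := by
    rw [hLdef, massRatio, mul_add, mul_div_cancel₀ _ hc.ne']
    linarith
  -- The weight of an edge misses boundary mass on a point much heavier than its neighbour in `A`.
  -- The light endpoints of such edges form `D`; the choice of `L` makes its mass at most `c / 16 *
  -- M`.
  let D : Finset V := Finset.univ.filter fun x => ∃ y, dist x y ≤ R ∧ L * μ x < μ y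
  have hD : ∑ x ∈ D, μ x ≤ c / 16 * M := by
    have h1 := sum_filter_exists_lt_le hμ hK D fun x hx => (Finset.mem_filter.1 hx).2
    have h2 : K * M ≤ c * L / 16 * M := mul_le_mul_of_nonneg_right (by linarith) hM0
    refine le_of_mul_le_mul_left ?_ hL0
    calc L * ∑ x ∈ D, μ x ≤ c * L / 16 * M := h1.trans h2
      _ = _ := by ring
  have hsdiff : ∑ x ∈ A, μ x ≤ ∑ x ∈ A \ D, μ x + ∑ x ∈ D, μ x := by
    rw [← Finset.sum_inter_add_sum_sdiff A D, add_comm]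
    refine add_le_add_right ?_ _
    exact Finset.sum_le_sum_of_subset_of_nonneg Finset.inter_subset_right fun x _ _ => hμ x
  have hcM : c * M ≤ M := mul_le_of_le_one_left hM0 hc1.le
  -- `1/4 - 1/16 ≥ 1/8`: this is why expansion is required from mass `M / 8` on.
  have hAD : 1 / 8 * M ≤ ∑ x ∈ A \ D, μ x := by linarith
  have hAD' : ∑ x ∈ A \ D, μ x ≤ 1 / 2 * M :=
    (Finset.sum_le_sum_of_subset_of_nonneg Finset.sdiff_subset fun x _ _ => hμ x).trans
      (by linarith)
  set N := Finset.univ.filter fun y => y ∉ A ∧ ∃ x ∈ A \ D, dist y x ≤ R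
  have hbd : ∑ y with y ∉ A \ D ∧ ∃ x ∈ A \ D, dist y x ≤ R, μ y
      ≤ ∑ y ∈ N, μ y + ∑ y ∈ D, μ y := by
    rw [← Finset.sum_union_inter]
    refine le_add_of_le_of_nonneg (Finset.sum_le_sum_of_subset_of_nonneg ?_ fun x _ _ => hμ x)
      (Finset.sum_nonneg fun x _ => hμ x)
    intro y hy
    simp only [Finset.mem_filter, Finset.mem_univ, true_and] at hy
    by_cases hyD : y ∈ D
    · exact Finset.mem_union_right _ hyD
    · refine Finset.mem_union_left _ (Finset.mem_filter.2 ⟨Finset.mem_univ _, fun hyA => ?_, hy.2⟩)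
      exact hy.1 (Finset.mem_sdiff.2 ⟨hyA, hyD⟩)
  have hNmass : c / 16 * M ≤ ∑ y ∈ N, μ y := by
    have h1 := hexp _ hAD hAD'
    have h2 := mul_le_mul_of_nonneg_left hAD hc.le
    linarith
  -- Each `y ∈ N` has a neighbour `x ∈ A \ D`, so `μ y ≤ L * μ x` and the edge between them weighs
  -- at least `μ y / L`.
  have hcut : ∑ y ∈ N, μ y ≤ L * ∑ x ∈ A, ∑ y ∈ Aᶜ, edgeWeight μ R x y := by
    calc ∑ y ∈ N, μ y ≤ ∑ y ∈ N, L * ∑ x ∈ A, edgeWeight μ R x y := by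
          refine Finset.sum_le_sum fun y hy => ?_
          obtain ⟨-, hyA, x, hx, hyx⟩ := Finset.mem_filter.1 hy
          rw [Finset.mem_sdiff] at hx
          have hle : μ y ≤ L * μ x := by
            by_contra! h
            exact hx.2 (Finset.mem_filter.2 ⟨Finset.mem_univ _, y, by rwa [dist_comm], h⟩)
          have hs := Finset.single_le_sum (f := fun x => edgeWeight μ R x y)
            (fun z _ => edgeWeight_nonneg hμ R z y) hx.1
          refine le_trans ?_ (mul_le_mul_of_nonneg_left hs hL0.le)
          simp only [edgeWeight, dist_comm x y, hyx, if_true]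
          rw [mul_min_of_nonneg _ _ hL0.le]
          exact le_min hle (le_mul_of_one_le_left (hμ y) (by linarith))
      _ ≤ ∑ y ∈ Aᶜ, L * ∑ x ∈ A, edgeWeight μ R x y :=
          Finset.sum_le_sum_of_subset_of_nonneg
            (fun y hy => Finset.mem_compl.2 (Finset.mem_filter.1 hy).2.1)
            fun y _ _ => mul_nonneg hL0.le
              (Finset.sum_nonneg fun x _ => edgeWeight_nonneg hμ R x y)
      _ = _ := by rw [← Finset.mul_sum, Finset.sum_comm]
  have h1 : c / (8 * L) * ∑ x ∈ A, μ x ≤ c / (8 * L) * (M / 2) :=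
    mul_le_mul_of_nonneg_left hA' (by positivity)
  refine h1.trans (le_of_mul_le_mul_left ?_ hL0)
  calc L * (c / (8 * L) * (M / 2)) = c / 16 * M := by field_simp; ring
    _ ≤ _ := hNmass.trans hcut

lemma exists_cut_expanding_subset_of_boundary [DecidableEq V] {μ : V → ℝ} (hμ : ∀ x, 0 ≤ μ x)
    {R K c : ℝ} (hc : 0 < c) (hc1 : c < 1) (hK0 : 0 ≤ K) (hM : 0 < ∑ x, μ x)
    (hK : ∀ x : V, ((Finset.univ.filter fun y => dist x y ≤ R).card : ℝ) ≤ K)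
    (hexp : ∀ A : Finset V, 1 / 8 * ∑ x, μ x ≤ ∑ x ∈ A, μ x →
      ∑ x ∈ A, μ x ≤ 1 / 2 * ∑ x, μ x →
      c * ∑ x ∈ A, μ x ≤ ∑ y with y ∉ A ∧ ∃ x ∈ A, dist y x ≤ R, μ y) :
    ∃ Y : Finset V, 3 / 4 * ∑ x, μ x ≤ ∑ x ∈ Y, μ x ∧
      ∀ B ⊆ Y, ∑ x ∈ B, μ x ≤ (∑ x ∈ Y, μ x) / 2 →
        c / (8 * massRatio c K) / 4 * ∑ x ∈ B, μ x ≤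
          ∑ x ∈ B, ∑ y ∈ Y \ B, edgeWeight μ R x y := by
  have : 0 < massRatio c K := by unfold massRatio; positivity
  exact exists_cut_expanding_subset μ hμ _ (edgeWeight_nonneg hμ R) (edgeWeight_comm μ R)
    (by positivity) hM (cut_of_boundary hμ hc hc1 hK0 hK hexp)

/-- If no point carries much mass and balls are small, then most pairs of points are far apart. -/
lemma sum_mul_mul_ge_of_far {μ : V → ℝ} (hμ : ∀ x, 0 ≤ μ x) {S K ε : ℝ}
    (hK : ∀ x : V, ((Finset.univ.filter fun y => dist x y ≤ S).card : ℝ) ≤ K)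
    (hsmall : ∀ x, μ x ≤ ε * ∑ x, μ x) (hε : 0 ≤ ε) (hKε : K * ε ≤ 1 / 16) {Y : Finset V}
    (hY : 3 / 4 * ∑ x, μ x ≤ ∑ x ∈ Y, μ x) (F : V → V → ℝ) (hF : ∀ x y, 0 ≤ F x y) {a : ℝ}
    (ha : 0 ≤ a) (hfar : ∀ x y, S < dist x y → a ≤ F x y) :
    a * ((∑ x, μ x) ^ 2 / 2) ≤ ∑ x ∈ Y, ∑ y ∈ Y, μ x * μ y * F x y := by
  set M := ∑ x, μ x
  have hM0 : 0 ≤ M := Finset.sum_nonneg fun x _ => hμ x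
  have hnear : ∑ x ∈ Y, ∑ y ∈ Y, (if dist x y ≤ S then μ x * μ y else 0) ≤ M ^ 2 / 16 := by
    calc ∑ x ∈ Y, ∑ y ∈ Y, (if dist x y ≤ S then μ x * μ y else 0)
        ≤ ∑ x, ∑ y, (if dist x y ≤ S then μ x * μ y else 0) := by
          have hnn : ∀ x y, 0 ≤ if dist x y ≤ S then μ x * μ y else 0 := fun x y => by
            split_ifs
            exacts [mul_nonneg (hμ x) (hμ y), le_rfl]
          refine le_trans (Finset.sum_le_sum fun x _ => Finset.sum_le_sum_of_subset_of_nonneg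
            (Finset.subset_univ Y) fun y _ _ => hnn x y) ?_
          exact Finset.sum_le_sum_of_subset_of_nonneg (Finset.subset_univ Y) fun x _ _ =>
            Finset.sum_nonneg fun y _ => hnn x y
      _ ≤ ∑ x, μ x * (1 / 16 * M) := by
          refine Finset.sum_le_sum fun x _ => ?_
          rw [← Finset.sum_filter, ← Finset.mul_sum]
          refine mul_le_mul_of_nonneg_left ?_ (hμ x)
          calc ∑ y with dist x y ≤ S, μ y ≤ ∑ y with dist x y ≤ S, ε * M :=
                Finset.sum_le_sum fun y _ => hsmall y
            _ = ((Finset.univ.filter fun y => dist x y ≤ S).card : ℝ) * (ε * M) := by simp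
            _ ≤ K * (ε * M) := mul_le_mul_of_nonneg_right (hK x) (by positivity)
            _ = K * ε * M := by ring
            _ ≤ 1 / 16 * M := mul_le_mul_of_nonneg_right hKε hM0
      _ = M ^ 2 / 16 := by rw [← Finset.sum_mul]; ring
  -- `(3/4)² = 9/16`; removing the near pairs, at most `1/16`, leaves the factor `1/2`.
  have hall : 9 / 16 * M ^ 2 ≤ ∑ x ∈ Y, ∑ y ∈ Y, μ x * μ y := by
    rw [← Finset.sum_mul_sum]
    nlinarith
  have hdiff : a * (∑ x ∈ Y, ∑ y ∈ Y, μ x * μ y -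
      ∑ x ∈ Y, ∑ y ∈ Y, (if dist x y ≤ S then μ x * μ y else 0)) ≤
      ∑ x ∈ Y, ∑ y ∈ Y, μ x * μ y * F x y := by
    rw [← Finset.sum_sub_distrib, Finset.mul_sum]
    refine Finset.sum_le_sum fun x _ => ?_
    rw [← Finset.sum_sub_distrib, Finset.mul_sum]
    refine Finset.sum_le_sum fun y _ => ?_
    have hxy := mul_nonneg (hμ x) (hμ y)
    split_ifs with h
    · rw [sub_self, mul_zero]
      exact mul_nonneg hxy (hF x y)
    · rw [sub_zero, mul_comm]
      exact mul_le_mul_of_nonneg_left (hfar x y (not_le.1 h)) hxy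
  exact (mul_le_mul_of_nonneg_left (by linarith) ha).trans hdiff

lemma sum_edgeWeight_mul_le {μ : V → ℝ} (hμ : ∀ x, 0 ≤ μ x) {R K b : ℝ} (hK0 : 0 ≤ K)
    (hK : ∀ x : V, ((Finset.univ.filter fun y => dist x y ≤ R).card : ℝ) ≤ K) (Y : Finset V)
    (F : V → V → ℝ) (hb : 0 ≤ b) (hF : ∀ x y, dist x y ≤ R → F x y ≤ b) :
    ∑ x ∈ Y, ∑ y ∈ Y, edgeWeight μ R x y * F x y ≤ K * b * ∑ x, μ x := by
  calc ∑ x ∈ Y, ∑ y ∈ Y, edgeWeight μ R x y * F x y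
      ≤ ∑ x ∈ Y, ∑ y ∈ Y, edgeWeight μ R x y * b := by
        refine Finset.sum_le_sum fun x _ => Finset.sum_le_sum fun y _ => ?_
        by_cases h : dist x y ≤ R
        · exact mul_le_mul_of_nonneg_left (hF x y h) (edgeWeight_nonneg hμ R x y)
        · simp [edgeWeight, h]
    _ ≤ ∑ x ∈ Y, K * b * μ x := by
        refine Finset.sum_le_sum fun x _ => ?_
        rw [← Finset.sum_mul]
        have := mul_le_mul_of_nonneg_right (sum_edgeWeight_le hμ Y x (hK x)) hb
        linarith
    _ ≤ ∑ x, K * b * μ x := Finset.sum_le_sum_of_subset_of_nonneg (Finset.subset_univ Y)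
        fun x _ _ => mul_nonneg (by positivity) (hμ x)
    _ = _ := (Finset.mul_sum _ _ _).symm

end MetricGraph

/-! ### Passing from measures to finite sums -/

section Translation

lemma card_closedBall_le_of_encard {V : Type*} [Fintype V] [MetricSpace V] {R : ℝ} {K : ℕ} {x : V}
    (h : (Metric.closedBall x R).encard ≤ K) :
    ((Finset.univ.filter fun y => dist x y ≤ R).card : ℝ) ≤ K := by
  have hset : Metric.closedBall x R =
      ((Finset.univ.filter fun y => dist x y ≤ R : Finset V) : Set V) := by
    ext y
    simp [dist_comm]
  rw [hset, Set.encard_coe_eq_coe_finsetCard] at h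
  exact_mod_cast h

lemma boundary_coe_finset {V : Type*} [Fintype V] [MetricSpace V] [DecidableEq V] {R : ℝ}
    (hR : 0 ≤ R) (A : Finset V) :
    boundary R (A : Set V) =
      ((Finset.univ.filter fun y => y ∉ A ∧ ∃ x ∈ A, dist y x ≤ R : Finset V) : Set V) := by
  ext y
  rw [boundary, (A.finite_toSet.isCompact).cthickening_eq_biUnion_closedBall hR]
  simp [and_comm]

lemma measureReal_coe_finset {V : Type*} [MeasurableSpace V] [DiscreteMeasurableSpace V]
    (m : Measure V) [IsFiniteMeasure m] (A : Finset V) : m.real A = ∑ x ∈ A, m.real {x} :=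
  (sum_measureReal_singleton A).symm

lemma IsGhostly.eventually_measureReal_le {X : ℕ → Type*} [∀ n, MeasurableSpace (X n)]
    {m : ∀ n, Measure (X n)} [∀ n, IsFiniteMeasure (m n)] (hghost : IsGhostly X m)
    (hm : ∀ n, m n ≠ 0) {ε : ℝ} (hε : 0 < ε) :
    ∀ᶠ n in atTop, ∀ x : X n, (m n).real {x} ≤ ε * (m n).real Set.univ := by
  filter_upwards [hghost.eventually (gt_mem_nhds (ENNReal.ofReal_pos.2 hε))] with n hn x
  have h1 : m n {x} / m n Set.univ ≤ ENNReal.ofReal ε :=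
    (le_iSup (fun x : X n => m n {x} / m n Set.univ) x).trans hn.le
  have h0 : m n Set.univ ≠ 0 := Measure.measure_univ_ne_zero.2 (hm n)
  rw [ENNReal.div_le_iff h0 (measure_ne_top _ _)] at h1
  have h2 := ENNReal.toReal_mono (ENNReal.mul_ne_top ENNReal.ofReal_ne_top (measure_ne_top _ _)) h1
  rwa [ENNReal.toReal_mul, ENNReal.toReal_ofReal hε.le] at h2

end Translation

end MeasuredExpanders

/-! ### The contradiction -/

theorem mainTheorem8 (X : ℕ → Type*) [∀ n, MetricSpace (X n)] [∀ n, Finite (X n)]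
    [∀ n, MeasurableSpace (X n)] [∀ n, DiscreteMeasurableSpace (X n)]
    (m : ∀ n, Measure (X n)) [∀ n, IsFiniteMeasure (m n)] (hm : ∀ n, m n ≠ 0)
    (hexp : MeasuredExpanders.IsMeasuredAsymptoticExpander X m)
    (hghost : MeasuredExpanders.IsGhostly X m)
    (hgeom : MeasuredExpanders.HasUniformlyBoundedGeometry X)
    [MetricSpace (Σ n, X n)] (hX : MeasuredExpanders.IsCoarseDisjointUnion X)
    (p : ℝ≥0∞) [Fact (1 ≤ p)] (hp : p ≠ ∞)
    (𝕜 : Type*) [RCLike 𝕜] {Z : Type*} [MeasurableSpace Z] (ν : Measure Z) :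
    ¬ ∃ f : (Σ n, X n) → Lp 𝕜 p ν, MeasuredExpanders.IsCoarseEmbedding f := by
  open MeasuredExpanders in
  rintro ⟨f, ρLo, ρUp, hLo, hUp, hLoTop, hf⟩
  classical
  have hp1 : 1 ≤ p := Fact.out
  have hr : 1 ≤ p.toReal := by
    simpa using ENNReal.toReal_mono hp hp1
  have hr0 : 0 < p.toReal := by linarith
  obtain ⟨c, R, hc, hc1, hR, hexp⟩ := hexp (1 / 8) (by norm_num) (by norm_num)
  obtain ⟨K, hK⟩ := hgeom R hR
  have hK0 : (0 : ℝ) ≤ K := Nat.cast_nonneg K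
  set c' : ℝ := c / (8 * massRatio c K) / 4
  have hc' : 0 < c' := by
    have : 0 < massRatio c K := by unfold massRatio; positivity
    positivity
  set C : ℝ := 2 ^ p.toReal * 2 * (2 ^ p.toReal * 4 * poincareConst c' K p.toReal)
  have hC : 0 ≤ C := by
    have := poincareConst_nonneg hc' hK0 hr
    positivity
  set b : ℝ := (ρUp R.toNNReal : ℝ) ^ p.toReal
  have hb : 0 ≤ b := by positivity
  have hTop : Tendsto (fun t => (ρLo t : ℝ) ^ p.toReal) atTop atTop :=
    (tendsto_rpow_atTop hr0).comp (NNReal.tendsto_coe_atTop.2 hLoTop)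
  -- `C`, `K` and `b` do not depend on `n`, so `S` can be fixed before `n`; the threshold is twice
  -- the Poincaré upper bound because far pairs account for only half of `M ^ 2`.
  obtain ⟨S, hS, hS0⟩ := ((hTop.eventually_gt_atTop (2 * (C * (K * b)))).and
    (eventually_gt_atTop 0)).exists
  obtain ⟨KS, hKS⟩ := hgeom S hS0
  have hKS0 : (0 : ℝ) ≤ KS := Nat.cast_nonneg KS
  -- Chosen so that `KS * ε ≤ 1 / 16`; the `+ 1` covers `KS = 0`.
  set ε : ℝ := 1 / (16 * (KS + 1)) with hεdef
  have hε : 0 < ε := by positivity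
  obtain ⟨n, hn⟩ := (hghost.eventually_measureReal_le hm hε).exists
  let _ : Fintype (X n) := Fintype.ofFinite (X n)
  set μ : X n → ℝ := fun x => (m n).real {x}
  have hμ : ∀ x, 0 ≤ μ x := fun x => measureReal_nonneg
  have htot : (m n).real Set.univ = ∑ x, μ x := by
    rw [← Finset.coe_univ, measureReal_coe_finset]
  have hM : 0 < ∑ x, μ x := by
    rw [← htot]
    exact ENNReal.toReal_pos (Measure.measure_univ_ne_zero.2 (hm n)) (measure_ne_top _ _)
  rw [htot] at hn
  have hball : ∀ x : X n, ((Finset.univ.filter fun y => dist x y ≤ R).card : ℝ) ≤ K :=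
    fun x => card_closedBall_le_of_encard (hK n x)
  obtain ⟨Y, hY, hYcut⟩ := exists_cut_expanding_subset_of_boundary hμ hc hc1 hK0 hM hball
    fun A h1 h2 => by
      have := hexp n A
      rw [boundary_coe_finset hR.le, measureReal_coe_finset, measureReal_coe_finset, htot] at this
      exact (this h1 h2).le
  set M := ∑ x, μ x
  have hYM : ∑ x ∈ Y, μ x ≤ M :=
    Finset.sum_le_sum_of_subset_of_nonneg (Finset.subset_univ Y) fun x _ _ => hμ x
  have hpoin := Lp_sum_mul_norm_sub_rpow_le (E := 𝕜) (ν := ν) hp1 hp Y (fun x y => μ x * μ y)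
    (edgeWeight μ R) (fun g => sum_mul_norm_sub_rpow_le_of_cut hμ (edgeWeight_nonneg hμ R)
      (edgeWeight_comm μ R) hc' hK0 hr (fun x _ => sum_edgeWeight_le hμ Y x (hball x)) hYcut g)
    (fun x => f ⟨n, x⟩)
  have hnn : ∀ x y : X n, nndist (⟨n, x⟩ : Σ n, X n) ⟨n, y⟩ = nndist x y := fun x y =>
    NNReal.eq (hX.dist_same n x y)
  have hup := sum_edgeWeight_mul_le hμ hK0 hball Y
    (fun x y => ‖f ⟨n, x⟩ - f ⟨n, y⟩‖ ^ p.toReal) hb fun x y hxy => by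
      refine Real.rpow_le_rpow (norm_nonneg _) ?_ hr0.le
      rw [← dist_eq_norm, ← coe_nndist]
      refine NNReal.coe_le_coe.2 ((hf _ _).2.trans (hUp ?_))
      rw [hnn, ← NNReal.coe_le_coe, coe_nndist, Real.coe_toNNReal _ hR.le]
      exact hxy
  have hlow := sum_mul_mul_ge_of_far hμ (fun x => card_closedBall_le_of_encard (hKS n x)) hn
    hε.le (by rw [hεdef, mul_one_div, div_le_div_iff₀ (by positivity) (by norm_num)]; linarith) hY
    (fun x y => ‖f ⟨n, x⟩ - f ⟨n, y⟩‖ ^ p.toReal) (fun x y => by positivity)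
    (a := (ρLo S : ℝ) ^ p.toReal) (by positivity) fun x y hxy => by
      refine Real.rpow_le_rpow (NNReal.coe_nonneg _) ?_ hr0.le
      rw [← dist_eq_norm, ← coe_nndist]
      refine NNReal.coe_le_coe.2 ((hLo ?_).trans (hf _ _).1)
      rw [hnn, ← NNReal.coe_le_coe, coe_nndist]
      exact hxy.le
  -- Both sides scale as `M ^ 2`, so the total mass cancels against the choice of `S`.
  have hchain : (ρLo S : ℝ) ^ p.toReal * (M ^ 2 / 2) ≤ C * M * (K * b * M) :=
    hlow.trans (hpoin.trans (mul_le_mul (mul_le_mul_of_nonneg_left hYM hC) hup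
      (Finset.sum_nonneg fun x _ => Finset.sum_nonneg fun y _ =>
        mul_nonneg (edgeWeight_nonneg hμ R x y) (by positivity)) (by positivity)))
  have hlt := mul_lt_mul_of_pos_right hS (by positivity : 0 < M ^ 2 / 2)
  linarith
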